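/- Let $\mathbb{T}=\mathbb{R}/\mathbb{Z}$ with Haar probability measure $dx$, and let $v:\mathbb{T}\to\mathbb{R}$ be a non-constant real-analytic function. For every $\kappa>0$ there is $\lambda_0=\lambda_0(v,\kappa)$ such that the following holds. Let $(\mathbb{Y},\mathscr{B},m)$ be any probability space, and let $f:\mathbb{Y}\to\mathbb{T}$ and $g:\mathbb{Y}\to\mathbb{Y}$ be any maps such that $T(x,y)=(x+f(y),\,g(y))$ is a measure-preserving transformation of $(\mathbb{T}\times\mathbb{Y},\,dx\otimes m)$. For $\lambda\in\mathbb{R}$ and $(x,y)\in\mathbb{T}\times\mathbb{Y}$ let $S_{(x,y),\lambda v}$ be the bounded operator on $\ell^2(\mathbb{Z}^+)$, $\mathbb{Z}^+=\{1,2,\dots\}$, given by $$(S_{(x,y),\lambda v}\phi)(n)=\phi(n+1)+\phi(n-1)+\lambda v\big(\pi_{\mathbb{T}}(T^n(x,y))\big)\phi(n),\qquad n\ge 1,\quad \phi(0):=0,$$ where $\pi_{\mathbb{T}}$ is the projection to $\mathbb{T}$. For $E\in\mathbb{R}$ let $$M_n(x,y,E)=\prod_{j=n}^{1}\begin{pmatrix}E-\lambda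 v(\pi_{\mathbb{T}}(T^j(x,y)))&-1\\1&0\end{pmatrix},\qquad L_n(E)=\frac1n\int_{\mathbb{Y}}\int_{\mathbb{T}}\log\|M_n(x,y,E)\|\,dx\,dm(y)\quad(n\ge1),$$ with the factors of $M_n$ ordered from $j=n$ on the left to $j=1$ on the right, and with $\|\cdot\|$ the operator norm induced by the Euclidean norm. If $\lambda>\lambda_0$ and $E$ belongs to the spectrum of $S_{(x_0,y_0),\lambda v}$ for some $(x_0,y_0)\in\mathbb{T}\times\mathbb{Y}$, then $\log\|M_n(\cdot,\cdot,E)\|$ is integrable with respect to $dx\otimes m$ for every $n$, the limit $L(E)=\lim_{n\to\infty}L_n(E)$ (the Lyapunov exponent) exists, and $$(1-\kappa)\log\lambda<L(E)<(1+\kappa)\log\lambda .$$ Here $\lambda_0$ depends only on $v$ and $\kappa$; it does not depend on $\mathbb{Y}$, $m$, $f$, $g$, $(x_0,y_0)$ or $E$. -/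

import Mathlib

open MeasureTheory Filter Topology
open scoped ENNReal

noncomputable section

namespace SkewSchrodinger

/-- The Hilbert space `ℓ²(ℤ⁺)`. -/
abbrev L2 : Type := lp (fun _ : ℕ+ => ℂ) 2

/-- The formal discrete Schrödinger expression on the half line,
`(H φ)(n) = φ(n+1) + φ(n-1) + V(n) φ(n)` for `n ≥ 1`, with the Dirichlet convention `φ(0) = 0`. -/
def schrodingerExpr (V : ℕ+ → ℝ) (φ : ℕ+ → ℂ) (n : ℕ+) : ℂ :=
  φ (n + 1) + (if n = 1 then 0 else φ (n - 1)) + (V n : ℂ) * φ n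

theorem memlp_two_iff (φ : ℕ+ → ℂ) :
    Memℓp φ 2 ↔ Summable fun n => ‖φ n‖ ^ 2 := by
  rw [memℓp_gen_iff (by norm_num)]
  norm_num

theorem memlp_schrodingerExpr {V : ℕ+ → ℝ} (hV : ∃ C : ℝ, ∀ n, |V n| ≤ C) {φ : ℕ+ → ℂ}
    (hφ : Memℓp φ 2) : Memℓp (schrodingerExpr V φ) 2 := by
  have hs := (memlp_two_iff φ).1 hφ
  have hinj : Function.Injective fun n : ℕ+ => n + 1 := fun a b h => add_right_cancel h
  have h1 : Memℓp (fun n => φ (n + 1)) 2 :=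
    (memlp_two_iff _).2 (hs.comp_injective hinj)
  have h2 : Memℓp (fun n : ℕ+ => if n = 1 then (0 : ℂ) else φ (n - 1)) 2 := by
    rw [memlp_two_iff, ← hinj.summable_iff]
    · refine hs.congr fun n => ?_
      have hn : n + 1 ≠ 1 := (PNat.lt_add_left 1 n).ne'
      simp [hn, PNat.add_sub]
    · intro n hn
      have : n = 1 := by
        by_contra h
        exact hn ⟨n - 1, PNat.sub_add_of_lt (lt_of_le_of_ne (_root_.one_le (a := n)) (Ne.symm h))⟩
      simp [this]
  have h3 : Memℓp (fun n => (V n : ℂ) * φ n) 2 := by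
    obtain ⟨C, hC⟩ := hV
    rw [memlp_two_iff]
    refine Summable.of_nonneg_of_le (fun n => by positivity) (fun n => ?_) (hs.mul_left (C ^ 2))
    rw [norm_mul, mul_pow, Complex.norm_real, Real.norm_eq_abs]
    have := hC n
    gcongr
  exact (h1.add h2).add h3

/-- The Schrödinger operator with a bounded potential, as a linear map of `ℓ²(ℤ⁺)`. -/
def schrodingerLinear (V : ℕ+ → ℝ) (hV : ∃ C : ℝ, ∀ n, |V n| ≤ C) : L2 →ₗ[ℂ] L2 where
  toFun φ := ⟨schrodingerExpr V φ, memlp_schrodingerExpr hV φ.2⟩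
  map_add' φ ψ := by
    ext n
    simp only [schrodingerExpr, lp.coeFn_add, Pi.add_apply]
    split_ifs <;> ring
  map_smul' c φ := by
    ext n
    simp only [schrodingerExpr, lp.coeFn_smul, Pi.smul_apply, smul_eq_mul, RingHom.id_apply]
    split_ifs <;> ring

theorem tendsto_lp_apply {u : ℕ → L2} {x : L2} (h : Tendsto u atTop (𝓝 x)) (n : ℕ+) :
    Tendsto (fun k => u k n) atTop (𝓝 (x n)) := by
  rw [tendsto_iff_norm_sub_tendsto_zero] at h ⊢
  refine squeeze_zero (fun _ => norm_nonneg _) (fun k => ?_) h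
  exact lp.norm_apply_le_norm (by norm_num) (u k - x) n

/-- The Schrödinger operator with a bounded potential, as a bounded operator on `ℓ²(ℤ⁺)`. -/
def schrodingerCLM (V : ℕ+ → ℝ) (hV : ∃ C : ℝ, ∀ n, |V n| ≤ C) : L2 →L[ℂ] L2 :=
  ContinuousLinearMap.ofSeqClosedGraph (g := schrodingerLinear V hV) (by
    intro u x y hx hy
    ext n
    refine tendsto_nhds_unique (tendsto_lp_apply hy n) ?_
    change Tendsto (fun k => schrodingerExpr V (u k) n) atTop (𝓝 (schrodingerExpr V x n))
    unfold schrodingerExpr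
    refine ((tendsto_lp_apply hx _).add ?_).add ((tendsto_lp_apply hx n).const_mul _)
    split_ifs
    · exact tendsto_const_nhds
    · exact tendsto_lp_apply hx _)

theorem schrodingerCLM_apply (V : ℕ+ → ℝ) (hV : ∃ C : ℝ, ∀ n, |V n| ≤ C) (φ : L2) (n : ℕ+) :
    schrodingerCLM V hV φ n =
      φ (n + 1) + (if n = 1 then 0 else φ (n - 1)) + (V n : ℂ) * φ n := rfl

section Dynamics

variable {Y : Type*}

/-- The map `T(x, y) = (x + f(y), g(y))` on `𝕋 × Y`. -/
def skewMap (f : Y → UnitAddCircle) (g : Y → Y) (p : UnitAddCircle × Y) : UnitAddCircle × Y :=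
  (p.1 + f p.2, g p.2)

/-- The sampled potential `λ v(π_𝕋 (Tⁿ p))`. -/
def potential (v : C(UnitAddCircle, ℝ)) (lam : ℝ) (f : Y → UnitAddCircle) (g : Y → Y)
    (p : UnitAddCircle × Y) (n : ℕ) : ℝ :=
  lam * v (((skewMap f g)^[n] p).1)

theorem potential_bounded (v : C(UnitAddCircle, ℝ)) (lam : ℝ) (f : Y → UnitAddCircle)
    (g : Y → Y) (p : UnitAddCircle × Y) :
    ∃ C : ℝ, ∀ n : ℕ+, |potential v lam f g p n| ≤ C := by
  refine ⟨|lam| * ‖v‖, fun n => ?_⟩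
  rw [potential, abs_mul]
  exact mul_le_mul_of_nonneg_left (v.norm_coe_le_norm _) (abs_nonneg _)

/-- The Schrödinger operator `S_{p, λv}` on `ℓ²(ℤ⁺)`, where `p = (x, y)`. -/
def schrodingerOp (v : C(UnitAddCircle, ℝ)) (lam : ℝ) (f : Y → UnitAddCircle) (g : Y → Y)
    (p : UnitAddCircle × Y) : L2 →L[ℂ] L2 :=
  schrodingerCLM (fun n : ℕ+ => potential v lam f g p n) (potential_bounded v lam f g p)

/-- The transfer matrix `M_n(p, E) = A(Tⁿ p) ⋯ A(T p)`, where
`A(q) = !![E - λ v(π_𝕋 q), -1; 1, 0]`. -/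
def transferMatrix (v : C(UnitAddCircle, ℝ)) (lam : ℝ) (f : Y → UnitAddCircle) (g : Y → Y)
    (E : ℝ) (p : UnitAddCircle × Y) : ℕ → Matrix (Fin 2) (Fin 2) ℝ
  | 0 => 1
  | n + 1 => !![E - potential v lam f g p (n + 1), -1; 1, 0] * transferMatrix v lam f g E p n

/-- `log ‖M_n(p, E)‖`, with the operator norm induced by the Euclidean norm of `ℝ²`. -/
def logNorm (v : C(UnitAddCircle, ℝ)) (lam : ℝ) (f : Y → UnitAddCircle) (g : Y → Y)
    (E : ℝ) (n : ℕ) (p : UnitAddCircle × Y) : ℝ :=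
  Real.log ‖Matrix.toEuclideanCLM (n := Fin 2) (𝕜 := ℝ) (transferMatrix v lam f g E p n)‖

/-- The finite-scale exponent `L_n(E) = (1/n) ∫_Y ∫_𝕋 log ‖M_n(x, y, E)‖ dx dm(y)`. -/
def finiteLyapunov [MeasurableSpace Y] (m : Measure Y) (v : C(UnitAddCircle, ℝ)) (lam : ℝ)
    (f : Y → UnitAddCircle) (g : Y → Y) (E : ℝ) (n : ℕ) : ℝ :=
  (1 / (n : ℝ)) * ∫ y, ∫ x : UnitAddCircle, logNorm v lam f g E n (x, y) ∂volume ∂m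

end Dynamics

end SkewSchrodinger

end

noncomputable section

namespace SkewSchrodinger

/-! ### Holomorphic extension to a strip, and lines avoiding a value -/

section Complexification

open Metric Set

/-! The potential `v` extends to a holomorphic periodic `V` on a strip. As `V` is not constant,
every real `E/λ` in a fixed bounded interval stays at distance at least `δ` from the values of `V`
on some horizontal line of small height `ε > 0` (`exists_line_norm_sub_ge_uniform`). On that line
every diagonal entry `E - λV` is of size at least `λδ`, so the first column of the complexified
cocycle grows at least like `(λδ/2)^n` (`transferColumn_lower`), whatever the base dynamics, which
enters only through real translations.

To return to the real axis, convexity in the height (`log_le_of_norm_ge_on_line`) compares the mean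
of `log ‖M_n‖` over `𝕋`, the growth at height `ε`, and an a priori bound `(λb)^n` on a larger strip.
Lower and upper bounds both scale as `λ^n`, so the interpolation loses only a constant: the mean is
at least `n (log λ - C)`, for each fixed `y`, with `C` independent of `λ` and of the dynamics
(`exists_le_integral_logNorm`).

The spectrum serves only to give `|E| ≤ λR`. The upper bound is the trivial product bound.
Invariance of the measure makes the integrals subadditive, which gives the limit, and the constants
are absorbed into `κ log λ`. -/

theorem exists_complex_extension_ball {u : ℝ → ℝ} {x : ℝ} (hu : AnalyticAt ℝ u x) :
    ∃ r > 0, ∃ F : ℂ → ℂ, DifferentiableOn ℂ F (ball (x : ℂ) r) ∧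
      ∀ t : ℝ, (t : ℂ) ∈ ball (x : ℂ) r → F t = u t := by
  obtain ⟨p, R, hp⟩ := hu
  obtain ⟨r, hr0, hrR⟩ := ENNReal.lt_iff_exists_nnreal_btwn.1 hp.r_pos
  have hr0 : (0 : ℝ) < r := by exact_mod_cast hr0
  have hrad : (r : ℝ≥0∞) < p.radius := hrR.trans_le hp.r_le
  have hsum : Summable fun n => ‖p n‖ * (r : ℝ) ^ n := p.summable_norm_mul_pow hrad
  refine ⟨r, hr0, fun z => ∑' n, (p.coeff n : ℂ) * (z - x) ^ n, ?_, ?_⟩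
  · refine Complex.differentiableOn_tsum_of_summable_norm hsum (fun n => ?_) isOpen_ball
      (fun n z hz => ?_)
    · fun_prop
    · rw [norm_mul, norm_pow, Complex.norm_real, p.norm_apply_eq_norm_coef]
      have : ‖z - x‖ ≤ r := (mem_ball_iff_norm.1 hz).le
      gcongr
  · intro t ht
    have ht' : t - x ∈ Metric.eball (0 : ℝ) R := by
      rw [Metric.mem_eball, edist_zero_right]
      refine lt_of_lt_of_le ?_ hrR.le
      rw [mem_ball_iff_norm, ← Complex.ofReal_sub, Complex.norm_real] at ht
      rw [enorm_eq_nnnorm]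
      exact_mod_cast ht
    have h := hp.hasSum ht'
    rw [add_sub_cancel] at h
    have h2 : HasSum (fun n => (((p n fun _ : Fin n => t - x) : ℝ) : ℂ)) (u t : ℂ) :=
      Complex.hasSum_ofReal.2 h
    rw [← h2.tsum_eq]
    refine tsum_congr fun n => ?_
    rw [p.apply_eq_pow_smul_coeff]
    push_cast [smul_eq_mul]
    ring

/-- A Lebesgue number for the cover of `[0,1]` by balls of extension makes the radius uniform;
periodicity carries it to all of `ℝ`. -/
theorem exists_complex_extension_ball_uniform {u : ℝ → ℝ} (hu : AnalyticOnNhd ℝ u univ)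
    (hper : Function.Periodic u 1) :
    ∃ r > 0, ∀ x : ℝ, ∃ F : ℂ → ℂ, DifferentiableOn ℂ F (ball (x : ℂ) r) ∧
      ∀ t : ℝ, (t : ℂ) ∈ ball (x : ℂ) r → F t = u t := by
  choose ρ hρ F hF hFu using fun x : ℝ => exists_complex_extension_ball (hu x (mem_univ x))
  have hK : IsCompact ((fun t : ℝ => (t : ℂ)) '' Icc 0 1) :=
    isCompact_Icc.image Complex.continuous_ofReal
  obtain ⟨r, hr, h⟩ := lebesgue_number_lemma_of_metric (c := fun x : ℝ => ball (x : ℂ) (ρ x)) hK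
    (fun x => isOpen_ball) (by
      rintro _ ⟨t, -, rfl⟩
      exact mem_iUnion.2 ⟨t, mem_ball_self (hρ t)⟩)
  refine ⟨r, hr, fun x => ?_⟩
  obtain ⟨i, hi⟩ := h _ ⟨Int.fract x, ⟨Int.fract_nonneg x, (Int.fract_lt_one x).le⟩, rfl⟩
  have hshift : ∀ z : ℂ, z ∈ ball (x : ℂ) r → z - ⌊x⌋ ∈ ball (i : ℂ) (ρ i) := by
    intro z hz
    refine hi ?_
    rw [mem_ball_iff_norm] at hz ⊢
    have : z - ⌊x⌋ - ((Int.fract x : ℝ) : ℂ) = z - x := by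
      rw [Int.fract]; push_cast; ring
    rwa [this]
  refine ⟨fun z => F i (z - ⌊x⌋), (hF i).comp (by fun_prop) hshift, fun t ht => ?_⟩
  have h1 := hFu i (t - ⌊x⌋) (by simpa using hshift t ht)
  push_cast at h1
  refine h1.trans ?_
  have := hper.sub_int_mul_eq (x := t) ⌊x⌋
  rw [mul_one] at this
  rw [this]

/-- The open horizontal strip of half-width `r` about the real axis. -/
def strip (r : ℝ) : Set ℂ := {z | |z.im| < r}

theorem isOpen_strip (r : ℝ) : IsOpen (strip r) :=
  isOpen_lt (by fun_prop) continuous_const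

theorem isPreconnected_strip (r : ℝ) : IsPreconnected (strip r) := by
  have h : strip r = Complex.imLm ⁻¹' Ioo (-r) r := by
    ext z; simp [strip, abs_lt]
  rw [h]
  exact ((convex_Ioo _ _).linear_preimage Complex.imLm).isPreconnected

theorem mem_ball_re_of_mem_strip {r : ℝ} {z : ℂ} (hz : z ∈ strip r) : z ∈ ball (z.re : ℂ) r := by
  have : z - z.re = z.im * Complex.I := by apply Complex.ext <;> simp
  rw [mem_ball_iff_norm, this]
  simpa [strip] using hz

theorem frequently_ofReal_nhdsNE (x : ℝ) {q : ℂ → Prop}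
    (h : ∀ᶠ t : ℝ in 𝓝 x, q t) : ∃ᶠ z in 𝓝[≠] (x : ℂ), q z := by
  have ht : Tendsto (fun t : ℝ => (t : ℂ)) (𝓝[≠] x) (𝓝[≠] (x : ℂ)) := by
    refine tendsto_nhdsWithin_iff.2 ⟨Complex.continuous_ofReal.continuousAt.mono_left
      nhdsWithin_le_nhds, ?_⟩
    filter_upwards [self_mem_nhdsWithin] with t ht
    simpa using ht
  exact ht.frequently (h.filter_mono nhdsWithin_le_nhds).frequently

/-- Each `z` is sent to the value at `z` of the local extension centred at `z.re`. Local extensions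
agree on overlaps because they agree on a real interval there; the identity theorem gives
periodicity in the same way. -/
theorem exists_strip_extension {u : ℝ → ℝ} (hu : AnalyticOnNhd ℝ u univ)
    (hper : Function.Periodic u 1) :
    ∃ r > 0, ∃ V : ℂ → ℂ, DifferentiableOn ℂ V (strip r) ∧ (∀ t : ℝ, V t = u t) ∧
      ∀ z ∈ strip r, V (z + 1) = V z := by
  obtain ⟨r, hr, h⟩ := exists_complex_extension_ball_uniform hu hper
  choose F hF hFu using h
  have hagree : ∀ x : ℝ, EqOn (fun z => F z.re z) (F x) (ball (x : ℂ) r ∩ strip r) := by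
    rintro x z ⟨hz, hzs⟩
    have hzre : (z.re : ℂ) ∈ ball (x : ℂ) r := by
      rw [mem_ball_iff_norm] at hz ⊢
      rw [← Complex.ofReal_sub, Complex.norm_real]
      have := Complex.abs_re_le_norm (z - x)
      simpa using this.trans_lt hz
    have hzz : z ∈ ball (z.re : ℂ) r := mem_ball_re_of_mem_strip hzs
    have ha : AnalyticOnNhd ℂ (F z.re) (ball (z.re : ℂ) r ∩ ball (x : ℂ) r) :=
      ((hF z.re).mono inter_subset_left).analyticOnNhd (isOpen_ball.inter isOpen_ball)
    have hb : AnalyticOnNhd ℂ (F x) (ball (z.re : ℂ) r ∩ ball (x : ℂ) r) :=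
      ((hF x).mono inter_subset_right).analyticOnNhd (isOpen_ball.inter isOpen_ball)
    have hU : (z.re : ℂ) ∈ ball (z.re : ℂ) r ∩ ball (x : ℂ) r := ⟨mem_ball_self hr, hzre⟩
    refine ha.eqOn_of_preconnected_of_frequently_eq hb
      ((convex_ball _ _).inter (convex_ball _ _)).isPreconnected hU ?_ ⟨hzz, hz⟩
    refine frequently_ofReal_nhdsNE _ ?_
    have : ∀ᶠ t : ℝ in 𝓝 z.re, (t : ℂ) ∈ ball (z.re : ℂ) r ∩ ball (x : ℂ) r :=
      Complex.continuous_ofReal.continuousAt.eventually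
        ((isOpen_ball.inter isOpen_ball).mem_nhds hU)
    filter_upwards [this] with t ht
    rw [hFu _ _ ht.1, hFu _ _ ht.2]
  have hdiff : DifferentiableOn ℂ (fun z => F z.re z) (strip r) := by
    intro z hz
    have hzz : z ∈ ball (z.re : ℂ) r := mem_ball_re_of_mem_strip hz
    have hopen : IsOpen (ball (z.re : ℂ) r ∩ strip r) := isOpen_ball.inter (isOpen_strip r)
    have hd : DifferentiableAt ℂ (F z.re) z :=
      (hF z.re).differentiableAt (isOpen_ball.mem_nhds hzz)
    refine (hd.congr_of_eventuallyEq ?_).differentiableWithinAt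
    filter_upwards [hopen.mem_nhds ⟨hzz, hz⟩] with w hw using hagree _ hw
  have hreal : ∀ t : ℝ, F (t : ℂ).re t = u t := fun t =>
    hFu _ _ (by simpa using hr)
  have h0 : ∀ t : ℝ, (t : ℂ) ∈ strip r := fun t => by simpa [strip] using hr
  refine ⟨r, hr, fun z => F z.re z, hdiff, hreal, ?_⟩
  have hA := hdiff.analyticOnNhd (isOpen_strip r)
  have hB : AnalyticOnNhd ℂ (fun z => (fun z => F z.re z) (z + 1)) (strip r) :=
    (hdiff.comp (f := fun z => z + 1) (by fun_prop) (fun z hz => by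
      simpa [strip] using hz)).analyticOnNhd (isOpen_strip r)
  refine hB.eqOn_of_preconnected_of_frequently_eq hA (isPreconnected_strip r) (h0 0)
    (frequently_ofReal_nhdsNE 0 (Eventually.of_forall fun t => ?_))
  have := hreal (t + 1)
  push_cast at this
  change F ((t : ℂ) + 1).re ((t : ℂ) + 1) = F (t : ℂ).re t
  rw [hreal, this, hper]

theorem apply_fract_add_mul_I {r : ℝ} {V : ℂ → ℂ} (hper : ∀ z ∈ strip r, V (z + 1) = V z)
    {ε : ℝ} (hε : |ε| < r) (x : ℝ) :
    V ((Int.fract x : ℝ) + ε * Complex.I) = V (x + ε * Complex.I) := by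
  have hP : Function.Periodic (fun x : ℝ => V (x + ε * Complex.I)) 1 := by
    intro x
    have := hper (x + ε * Complex.I) (by simpa [strip] using hε)
    simp only
    rw [← this]
    congr 1
    push_cast
    ring
  have := hP.sub_int_mul_eq (x := x) ⌊x⌋
  rw [mul_one] at this
  exact this

theorem exists_norm_le_of_periodic {r ρ : ℝ} (hρr : ρ < r) {V : ℂ → ℂ}
    (hV : ContinuousOn V (strip r)) (hper : ∀ z ∈ strip r, V (z + 1) = V z) :
    ∃ B, ∀ z : ℂ, |z.im| ≤ ρ → ‖V z‖ ≤ B := by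
  have hK : IsCompact ((fun q : ℝ × ℝ => (q.1 + q.2 * Complex.I : ℂ)) ''
      (Icc 0 1 ×ˢ Icc (-ρ) ρ)) :=
    (isCompact_Icc.prod isCompact_Icc).image (by fun_prop)
  obtain ⟨B, hB⟩ := hK.exists_bound_of_continuousOn (hV.mono (by
    rintro _ ⟨q, hq, rfl⟩
    simpa [strip] using (abs_le.2 hq.2).trans_lt hρr))
  refine ⟨B, fun z hz => ?_⟩
  rw [← Complex.re_add_im z, ← apply_fract_add_mul_I hper (hz.trans_lt hρr)]
  exact hB _ ⟨(Int.fract z.re, z.im),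
    ⟨⟨Int.fract_nonneg _, (Int.fract_lt_one _).le⟩, abs_le.1 hz⟩, rfl⟩

/-- If every line of height in `(0, ρ]` met `V = c`, the solutions, moved into one period, would
have distinct heights and hence accumulate in a compact part of the strip, forcing `V` to be
constant. On a line free of solutions, compactness of a period gives `δ`. -/
theorem exists_line_norm_sub_ge {r ρ : ℝ} (hρ : 0 < ρ) (hρr : ρ < r) {V : ℂ → ℂ}
    (hV : DifferentiableOn ℂ V (strip r)) (hper : ∀ z ∈ strip r, V (z + 1) = V z)
    (hne : ∃ s t : ℝ, V s ≠ V t) (c : ℂ) :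
    ∃ ε ∈ Ioc 0 ρ, ∃ δ > 0, ∀ x : ℝ, δ ≤ ‖V (x + ε * Complex.I) - c‖ := by
  have hmem : ∀ ε ∈ Ioc 0 ρ, ∀ x : ℝ, (x + ε * Complex.I : ℂ) ∈ strip r := by
    intro ε hε x
    simpa [strip, abs_of_pos hε.1] using hε.2.trans_lt hρr
  have key : ∃ ε ∈ Ioc 0 ρ, ∀ x ∈ Icc (0 : ℝ) 1, V (x + ε * Complex.I) ≠ c := by
    by_contra! hcon
    choose! x hx hxc using hcon
    have hK : IsCompact ((fun q : ℝ × ℝ => (q.1 + q.2 * Complex.I : ℂ)) ''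
        (Icc 0 1 ×ˢ Icc 0 ρ)) :=
      (isCompact_Icc.prod isCompact_Icc).image (by fun_prop)
    have hinf : ((fun ε : ℝ => (x ε + ε * Complex.I : ℂ)) '' Ioc 0 ρ).Infinite := by
      refine (Ioc_infinite hρ).image fun a _ b _ hab => ?_
      simpa using congrArg Complex.im hab
    obtain ⟨z, hzK, hz⟩ := hinf.exists_accPt_of_subset_isCompact hK (by
      rintro _ ⟨ε, hε, rfl⟩
      exact ⟨(x ε, ε), ⟨hx ε hε, hε.1.le, hε.2⟩, rfl⟩)
    have hzs : z ∈ strip r := by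
      obtain ⟨q, hq, rfl⟩ := hzK
      simpa [strip, abs_of_nonneg hq.2.1] using hq.2.2.trans_lt hρr
    have hfr : ∃ᶠ w in 𝓝[≠] z, V w = c := by
      refine (accPt_iff_frequently_nhdsNE.1 hz).mono ?_
      rintro _ ⟨ε, hε, rfl⟩
      exact hxc ε hε
    have := (hV.analyticOnNhd (isOpen_strip r)).eqOn_of_preconnected_of_frequently_eq
      (analyticOnNhd_const (v := c)) (isPreconnected_strip r) hzs hfr
    obtain ⟨s, t, hst⟩ := hne
    have h0 : ∀ t : ℝ, (t : ℂ) ∈ strip r := fun t => by simpa [strip] using hρ.trans hρr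
    exact hst ((this (h0 s)).trans (this (h0 t)).symm)
  obtain ⟨ε, hε, hne⟩ := key
  have hcont : Continuous fun x : ℝ => ‖V (x + ε * Complex.I) - c‖ := by
    refine (Continuous.sub ?_ continuous_const).norm
    exact hV.continuousOn.comp_continuous (by fun_prop) (hmem ε hε)
  obtain ⟨x₀, hx₀, hmin⟩ := (isCompact_Icc (a := (0 : ℝ)) (b := 1)).exists_isMinOn
    ⟨0, by simp⟩ hcont.continuousOn
  refine ⟨ε, hε, _, norm_pos_iff.2 (sub_ne_zero.2 (hne x₀ hx₀)), fun x => ?_⟩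
  rw [← apply_fract_add_mul_I hper (by simpa [abs_of_pos hε.1] using hε.2.trans_lt hρr) x]
  exact hmin ⟨Int.fract_nonneg x, (Int.fract_lt_one x).le⟩

/-- A line good for `c` is good for nearby values with `δ / 2`. Compactness makes `δ` uniform, while
the height `ε` may still depend on `c`. -/
theorem exists_line_norm_sub_ge_uniform {r ρ : ℝ} (hρ : 0 < ρ) (hρr : ρ < r) {V : ℂ → ℂ}
    (hV : DifferentiableOn ℂ V (strip r)) (hper : ∀ z ∈ strip r, V (z + 1) = V z)
    (hne : ∃ s t : ℝ, V s ≠ V t) {K : Set ℂ} (hK : IsCompact K) :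
    ∃ δ > 0, ∀ c ∈ K, ∃ ε ∈ Ioc 0 ρ, ∀ x : ℝ, δ ≤ ‖V (x + ε * Complex.I) - c‖ := by
  refine hK.induction_on (p := fun S => ∃ δ > 0, ∀ c ∈ S, ∃ ε ∈ Ioc 0 ρ, ∀ x : ℝ,
    δ ≤ ‖V (x + ε * Complex.I) - c‖) ⟨1, one_pos, by simp⟩ ?_ ?_ ?_
  · rintro S T hST ⟨δ, hδ, h⟩
    exact ⟨δ, hδ, fun c hc => h c (hST hc)⟩
  · rintro S T ⟨δ, hδ, h⟩ ⟨δ', hδ', h'⟩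
    refine ⟨min δ δ', lt_min hδ hδ', ?_⟩
    rintro c (hc | hc)
    · obtain ⟨ε, hε, hx⟩ := h c hc
      exact ⟨ε, hε, fun x => (min_le_left _ _).trans (hx x)⟩
    · obtain ⟨ε, hε, hx⟩ := h' c hc
      exact ⟨ε, hε, fun x => (min_le_right _ _).trans (hx x)⟩
  · intro c _
    obtain ⟨ε, hε, δ, hδ, hx⟩ := exists_line_norm_sub_ge hρ hρr hV hper hne c
    refine ⟨ball c (δ / 2), mem_nhdsWithin_of_mem_nhds (ball_mem_nhds _ (half_pos hδ)),
      δ / 2, half_pos hδ, fun d hd => ⟨ε, hε, fun x => ?_⟩⟩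
    have h1 := norm_sub_le_norm_sub_add_norm_sub (V (x + ε * Complex.I)) d c
    have h2 := mem_ball_iff_norm.1 hd
    have h3 := hx x
    linarith

end Complexification

/-! ### Three lines theorem with a mean on the real axis -/

section ThreeLines

open Set Complex.HadamardThreeLines

/-- Riemann sums converge uniformly in the base point `x`, by uniform continuity of `h`. -/
theorem exists_forall_sum_le_mul_integral_add {h : UnitAddCircle → ℝ} (hh : Continuous h) {η : ℝ}
    (hη : 0 < η) :
    ∃ N : ℕ, 0 < N ∧ ∀ x : ℝ, ∑ k ∈ Finset.range N, h ((x + k / N : ℝ) : UnitAddCircle) ≤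
      N * ((∫ y, h y) + η) := by
  set H : ℝ → ℝ := fun t => h (t : UnitAddCircle) with hH
  have hHc : Continuous H := hh.comp (AddCircle.continuous_mk' 1)
  have hHu : UniformContinuous H :=
    (CompactSpace.uniformContinuous_of_continuous hh).comp
      (uniformContinuous_of_continuousAt_zero
        (QuotientAddGroup.mk' (AddSubgroup.zmultiples (1 : ℝ)))
        (AddCircle.continuous_mk' 1).continuousAt)
  obtain ⟨δ, hδ, hδH⟩ := Metric.uniformContinuous_iff.1 hHu η hη
  obtain ⟨n, hn⟩ := exists_nat_one_div_lt hδ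
  refine ⟨n + 1, n.succ_pos, fun x => ?_⟩
  set N : ℕ := n + 1 with hN
  have hN0 : (0 : ℝ) < N := by positivity
  have hNδ : 1 / (N : ℝ) < δ := by simpa [hN] using hn
  have hint : ∀ a b, IntervalIntegrable H volume a b := fun a b => hHc.intervalIntegrable a b
  have hJ : (∫ y, h y) = ∑ k ∈ Finset.range N,
      ∫ t in (x + (k : ℕ) / N)..(x + (k + 1 : ℕ) / N), H t := by
    rw [intervalIntegral.sum_integral_adjacent_intervals
      (a := fun k : ℕ => x + (k : ℝ) / N) fun k _ => hint _ _,
      ← UnitAddCircle.intervalIntegral_preimage x h]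
    simp [hN0.ne', hH]
  have hk : ∀ k ∈ Finset.range N, (H (x + k / N) - η) / N ≤
      ∫ t in (x + (k : ℕ) / N)..(x + (k + 1 : ℕ) / N), H t := by
    intro k _
    have hlen : x + ((k + 1 : ℕ) : ℝ) / N - (x + (k : ℝ) / N) = 1 / N := by push_cast; ring
    have hpos : 0 < 1 / (N : ℝ) := by positivity
    have hle : x + (k : ℝ) / N ≤ x + ((k + 1 : ℕ) : ℝ) / N := by linarith
    calc (H (x + k / N) - η) / N
        = ∫ t in (x + (k : ℕ) / N)..(x + (k + 1 : ℕ) / N), (H (x + k / N) - η) := by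
          rw [intervalIntegral.integral_const, hlen, smul_eq_mul]; ring
      _ ≤ _ := by
          refine intervalIntegral.integral_mono_on hle (by simp) (hint _ _) fun t ht => ?_
          have := hδH (a := t) (b := x + k / N) (by
            rw [Real.dist_eq, abs_of_nonneg (by linarith [ht.1])]
            linarith [ht.2])
          rw [Real.dist_eq] at this
          linarith [(abs_lt.1 this).1]
  have hsum := Finset.sum_le_sum hk
  rw [← hJ, ← Finset.sum_div, div_le_iff₀ hN0, Finset.sum_sub_distrib, Finset.sum_const,
    Finset.card_range, nsmul_eq_mul] at hsum
  change ∑ k ∈ Finset.range N, H (x + k / N) ≤ _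
  linarith

/-- Hadamard's theorem sees only the supremum on the edge, whereas the mean of `h` is wanted.
Multiplying `N` equally spaced translates of `a` turns the edge bound into a Riemann sum, nearly `N
∫ h` uniformly; the factor `N` cancels after taking logarithms. -/
theorem log_le_of_norm_ge_on_line {r ρ ε K B : ℝ} (hε : 0 < ε) (hερ : ε ≤ ρ) (hρr : ρ < r)
    (hK : 0 < K) (hB : 0 < B) {a : ℂ → ℂ} (ha : DifferentiableOn ℂ a (strip r))
    (hlow : ∀ x : ℝ, K ≤ ‖a (x + ε * Complex.I)‖)
    (hup : ∀ z : ℂ, |z.im| ≤ ρ → ‖a z‖ ≤ B)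
    {h : UnitAddCircle → ℝ} (hh : Continuous h)
    (hah : ∀ x : ℝ, ‖a x‖ ≤ Real.exp (h (x : UnitAddCircle))) :
    Real.log K ≤ (1 - ε / ρ) * (∫ y, h y) + ε / ρ * Real.log B := by
  have hρ : 0 < ρ := hε.trans_le hερ
  refine le_of_forall_pos_le_add fun η hη => ?_
  obtain ⟨N, hN, hsum⟩ := exists_forall_sum_le_mul_integral_add hh hη
  have hN0 : (0 : ℝ) < N := by exact_mod_cast hN
  set J := ∫ y, h y
  -- Multiplication by `I` turns the vertical strip of the three lines theorem into a horizontal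
  -- one: the height is `s.re`.
  set F : ℂ → ℂ := fun s => ∏ k ∈ Finset.range N, a (Complex.I * s + ((k / N : ℝ) : ℂ)) with hF
  have him : ∀ (s : ℂ) (c : ℝ), (Complex.I * s + (c : ℂ)).im = s.re := by simp
  have hFB : ∀ s ∈ verticalClosedStrip 0 ρ, ‖F s‖ ≤ B ^ N := by
    intro s hs
    rw [hF, norm_prod]
    refine (Finset.prod_le_prod (fun _ _ => norm_nonneg _) fun k _ => hup _ ?_).trans_eq
      (by simp)
    rw [him, abs_of_nonneg hs.1]
    exact hs.2
  have hFd : DiffContOnCl ℂ F (verticalStrip 0 ρ) := by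
    refine DifferentiableOn.diffContOnCl (DifferentiableOn.fun_finsetProd fun k _ => ?_)
    refine ha.comp (by fun_prop) fun s hs => ?_
    have hcl : s ∈ verticalClosedStrip 0 ρ :=
      closure_minimal (preimage_mono Ioo_subset_Icc_self)
        (isClosed_Icc.preimage Complex.continuous_re) hs
    change |_| < r
    rw [him, abs_of_nonneg hcl.1]
    exact hcl.2.trans_lt hρr
  have hleft : ∀ s ∈ Complex.re ⁻¹' {(0 : ℝ)}, ‖F s‖ ≤ Real.exp (N * (J + η)) := by
    intro s hs
    have hsre : s.re = 0 := hs
    have hs' : ∀ c : ℝ, Complex.I * s + (c : ℂ) = ((-s.im + c : ℝ) : ℂ) := fun c => by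
      apply Complex.ext <;> simp [hsre]
    rw [hF, norm_prod]
    refine (Finset.prod_le_prod (g := fun k : ℕ => Real.exp (h ((-s.im + k / N : ℝ) :
      UnitAddCircle))) (fun _ _ => norm_nonneg _) fun k _ => ?_).trans ?_
    · rw [hs']
      exact hah _
    · rw [← Real.exp_sum]
      exact Real.exp_le_exp.2 (hsum _)
  have hright : ∀ s ∈ Complex.re ⁻¹' {ρ}, ‖F s‖ ≤ B ^ N := fun s hs =>
    hFB s ⟨by rw [hs]; exact hρ.le, by rw [hs]⟩
  have key := norm_le_interp_of_mem_verticalClosedStrip' (z := (ε : ℂ)) hρ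
    ⟨by simpa using hε.le, by simpa using hερ⟩ hFd
    ⟨B ^ N, by rintro _ ⟨s, hs, rfl⟩; exact hFB s hs⟩ hleft hright
  have hKF : K ^ N ≤ ‖F ε‖ := by
    rw [hF, norm_prod]
    refine Eq.trans_le (by simp) (Finset.prod_le_prod (f := fun _ : ℕ => K) (fun _ _ => hK.le)
      fun k _ => ?_)
    refine (hlow (k / N)).trans_eq (congrArg (fun z => ‖a z‖) ?_)
    push_cast
    ring
  have hlog := Real.log_le_log (by positivity) (hKF.trans key)
  rw [Real.log_pow, Real.log_mul (by positivity) (by positivity), Real.log_rpow (by positivity),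
    Real.log_rpow (by positivity), Real.log_exp, Real.log_pow] at hlog
  simp only [Complex.ofReal_re, sub_zero] at hlog
  have h1 : Real.log K ≤ (1 - ε / ρ) * (J + η) + ε / ρ * Real.log B := by
    refine le_of_mul_le_mul_left ?_ hN0
    linarith
  have h2 : 0 ≤ ε / ρ * η := by positivity
  linarith

end ThreeLines

/-! ### Growth of the first column -/

section Recursion

/-- The first column of the product of the transfer matrices `!![w j, -1; 1, 0]`,
`j = n, …, 1`. -/
def transferColumn (w : ℕ → ℂ) : ℕ → ℂ × ℂ
  | 0 => (1, 0)
  | n + 1 => (w (n + 1) * (transferColumn w n).1 - (transferColumn w n).2, (transferColumn w n).1)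

/-- The cone where the second entry is dominated by the first is invariant: there `‖w a - b‖ ≥ (K +
1)‖a‖ - ‖b‖ ≥ K‖a‖`. -/
theorem transferColumn_lower {w : ℕ → ℂ} {K : ℝ} (hK : 1 ≤ K) (hw : ∀ n, K + 1 ≤ ‖w n‖) (n : ℕ) :
    K ^ n ≤ ‖(transferColumn w n).1‖ ∧
      ‖(transferColumn w n).2‖ ≤ ‖(transferColumn w n).1‖ := by
  induction n with
  | zero => simp [transferColumn]
  | succ n ih =>
    obtain ⟨h1, h2⟩ := ih
    have h3 : K * ‖(transferColumn w n).1‖ ≤ ‖(transferColumn w (n + 1)).1‖ := by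
      have := norm_sub_norm_le (w (n + 1) * (transferColumn w n).1) (transferColumn w n).2
      rw [norm_mul] at this
      have h4 := mul_le_mul_of_nonneg_right (hw (n + 1)) (norm_nonneg (transferColumn w n).1)
      simp only [transferColumn]
      linarith
    refine ⟨?_, ?_⟩
    · rw [pow_succ']
      exact (mul_le_mul_of_nonneg_left h1 (by linarith)).trans h3
    · exact (le_mul_of_one_le_left (norm_nonneg _) hK).trans h3

theorem transferColumn_upper {w : ℕ → ℂ} {B : ℝ} (hw : ∀ n, ‖w n‖ ≤ B) (n : ℕ) :
    ‖(transferColumn w n).1‖ ≤ (B + 1) ^ n ∧ ‖(transferColumn w n).2‖ ≤ (B + 1) ^ n := by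
  have hB : 0 ≤ B := (norm_nonneg _).trans (hw 0)
  induction n with
  | zero => simp [transferColumn]
  | succ n ih =>
    obtain ⟨h1, h2⟩ := ih
    refine ⟨?_, ?_⟩
    · have := norm_sub_le (w (n + 1) * (transferColumn w n).1) (transferColumn w n).2
      rw [norm_mul] at this
      have h4 : ‖w (n + 1)‖ * ‖(transferColumn w n).1‖ ≤ B * (B + 1) ^ n := by
        gcongr
        exact hw _
      simp only [transferColumn]
      rw [pow_succ]
      linarith
    · simp only [transferColumn]
      refine h1.trans (pow_le_pow_right₀ (by linarith) n.le_succ)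

theorem differentiableOn_transferColumn {W : ℕ → ℂ → ℂ} {U : Set ℂ}
    (hW : ∀ n, DifferentiableOn ℂ (W n) U) (n : ℕ) :
    DifferentiableOn ℂ (fun z => (transferColumn (fun j => W j z) n).1) U ∧
      DifferentiableOn ℂ (fun z => (transferColumn (fun j => W j z) n).2) U := by
  induction n with
  | zero => exact ⟨differentiableOn_const _, differentiableOn_const _⟩
  | succ n ih => exact ⟨((hW _).mul ih.1).sub ih.2, ih.1⟩

end Recursion

/-! ### Bound on the energy -/

section Spectrum

theorem norm_schrodingerCLM_le {V : ℕ+ → ℝ} {C : ℝ} (hC0 : 0 ≤ C) (hC : ∀ n, |V n| ≤ C) :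
    ‖schrodingerCLM V ⟨C, hC⟩‖ ≤ 3 * (C + 2) := by
  refine ContinuousLinearMap.opNorm_le_bound _ (by positivity) fun φ => ?_
  refine lp.norm_le_of_forall_sum_le (by norm_num) (by positivity) fun s => ?_
  have hp : (2 : ℝ≥0∞).toReal = ((2 : ℕ) : ℝ) := by norm_num
  have hφ : ∀ t : Finset ℕ+, ∑ n ∈ t, ‖φ n‖ ^ 2 ≤ ‖φ‖ ^ 2 := by
    intro t
    have := lp.sum_rpow_le_norm_rpow (by norm_num) φ t
    simpa only [hp, Real.rpow_natCast] using this
  simp only [hp, Real.rpow_natCast]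
  have h1 : ∑ n ∈ s, ‖φ (n + 1)‖ ^ 2 ≤ ‖φ‖ ^ 2 := by
    have h := hφ (s.map (addRightEmbedding 1))
    simpa using h
  have h2 : ∑ n ∈ s, ‖if n = 1 then (0 : ℂ) else φ (n - 1)‖ ^ 2 ≤ ‖φ‖ ^ 2 := by
    have h := hφ ((s.filter (· ≠ 1)).image fun n => n - 1)
    rw [Finset.sum_image] at h
    · rw [Finset.sum_filter] at h
      refine (Finset.sum_le_sum fun n _ => ?_).trans h
      by_cases hn : n = 1 <;> simp [hn]
    · intro a ha b hb hab
      have hadd : ∀ n : ℕ+, n ≠ 1 → n - 1 + 1 = n := fun n hn =>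
        PNat.sub_add_of_lt (lt_of_le_of_ne (_root_.one_le (a := n)) (Ne.symm hn))
      have ha' := hadd a (Finset.mem_filter.1 (Finset.mem_coe.1 ha)).2
      have hb' := hadd b (Finset.mem_filter.1 (Finset.mem_coe.1 hb)).2
      simp only at hab
      rw [← ha', ← hb', hab]
  have h3 := hφ s
  have hpt : ∀ n ∈ s, ‖schrodingerCLM V ⟨C, hC⟩ φ n‖ ^ 2 ≤
      3 * ‖φ (n + 1)‖ ^ 2 + 3 * ‖if n = 1 then (0 : ℂ) else φ (n - 1)‖ ^ 2
        + 3 * C ^ 2 * ‖φ n‖ ^ 2 := by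
    intro n _
    rw [schrodingerCLM_apply]
    set x := φ (n + 1)
    set y := if n = 1 then (0 : ℂ) else φ (n - 1)
    have hz : ‖(V n : ℂ) * φ n‖ ≤ C * ‖φ n‖ := by
      rw [norm_mul, Complex.norm_real, Real.norm_eq_abs]
      exact mul_le_mul_of_nonneg_right (hC n) (norm_nonneg _)
    have hn : ‖x + y + (V n : ℂ) * φ n‖ ≤ ‖x‖ + ‖y‖ + C * ‖φ n‖ :=
      norm_add₃_le.trans (by linarith)
    have := pow_le_pow_left₀ (norm_nonneg _) hn 2
    nlinarith [sq_nonneg (‖x‖ - ‖y‖), sq_nonneg (‖y‖ - C * ‖φ n‖), sq_nonneg (‖x‖ - C * ‖φ n‖)]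
  refine (Finset.sum_le_sum hpt).trans ?_
  rw [Finset.sum_add_distrib, Finset.sum_add_distrib, ← Finset.mul_sum, ← Finset.mul_sum,
    ← Finset.mul_sum]
  have h4 := mul_le_mul_of_nonneg_left h3 (by positivity : 0 ≤ 3 * C ^ 2)
  have h5 : 0 ≤ C * ‖φ‖ ^ 2 := by positivity
  have h6 : 0 ≤ C ^ 2 * ‖φ‖ ^ 2 := by positivity
  have h7 : 0 ≤ ‖φ‖ ^ 2 := by positivity
  nlinarith

theorem abs_le_of_mem_spectrum {Y : Type*} {v : C(UnitAddCircle, ℝ)} {lam : ℝ}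
    {f : Y → UnitAddCircle} {g : Y → Y} {p : UnitAddCircle × Y} {E : ℝ} (hlam : 1 ≤ lam)
    (hE : (E : ℂ) ∈ spectrum ℂ (schrodingerOp v lam f g p)) :
    |E| ≤ lam * (3 * (‖v‖ + 2)) := by
  have h := spectrum.norm_le_norm_mul_of_mem hE
  have h1 : ‖(1 : L2 →L[ℂ] L2)‖ ≤ 1 := ContinuousLinearMap.norm_id_le
  have h2 : ‖schrodingerOp v lam f g p‖ ≤ 3 * (lam * ‖v‖ + 2) := by
    refine norm_schrodingerCLM_le (by positivity) fun n => ?_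
    rw [potential, abs_mul, abs_of_pos (by linarith)]
    exact mul_le_mul_of_nonneg_left (v.norm_coe_le_norm _) (by linarith)
  rw [Complex.norm_real, Real.norm_eq_abs] at h
  have h3 := mul_le_mul h2 h1 (norm_nonneg _) (by positivity)
  linarith

end Spectrum

/-! ### Euclidean operator norm of 2 × 2 matrices -/

section MatrixNorm

open Matrix

theorem abs_apply_le_norm_toEuclideanCLM (M : Matrix (Fin 2) (Fin 2) ℝ) (i j : Fin 2) :
    |M i j| ≤ ‖toEuclideanCLM (n := Fin 2) (𝕜 := ℝ) M‖ := by
  have h := (toEuclideanCLM (n := Fin 2) (𝕜 := ℝ) M).le_opNorm (EuclideanSpace.single j 1)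
  have h2 := PiLp.norm_apply_le (toEuclideanCLM (n := Fin 2) (𝕜 := ℝ) M
    (EuclideanSpace.single j 1)) i
  simp only [EuclideanSpace.single, PiLp.norm_single, norm_one, mul_one] at h
  rw [ofLp_toEuclideanCLM] at h2
  simpa using h2.trans h

/-- Entries all below `1/2` would give a determinant of at most `1/2`. The constant is not sharp; it
only keeps the logarithm of the norm bounded below. -/
theorem half_le_norm_toEuclideanCLM {M : Matrix (Fin 2) (Fin 2) ℝ} (hM : M.det = 1) :
    1 / 2 ≤ ‖toEuclideanCLM (n := Fin 2) (𝕜 := ℝ) M‖ := by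
  by_contra! hlt
  have h : ∀ i j, |M i j| < 1 / 2 := fun i j =>
    (abs_apply_le_norm_toEuclideanCLM M i j).trans_lt hlt
  rw [det_fin_two] at hM
  have h1 : |M 0 0 * M 1 1| ≤ 1 / 2 * (1 / 2) := by
    rw [abs_mul]; exact mul_le_mul (h _ _).le (h _ _).le (abs_nonneg _) (by norm_num)
  have h2 : |M 0 1 * M 1 0| ≤ 1 / 2 * (1 / 2) := by
    rw [abs_mul]; exact mul_le_mul (h _ _).le (h _ _).le (abs_nonneg _) (by norm_num)
  have := (abs_le.1 h1).2
  have := (abs_le.1 h2).1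
  linarith

theorem norm_toEuclideanCLM_step_le (w : ℝ) :
    ‖toEuclideanCLM (n := Fin 2) (𝕜 := ℝ) !![w, -1; 1, 0]‖ ≤ 2 * (|w| + 1) := by
  refine ContinuousLinearMap.opNorm_le_bound _ (by positivity) fun x => ?_
  refine abs_le_of_sq_le_sq' ?_ (by positivity) |>.2
  rw [mul_pow, EuclideanSpace.real_norm_sq_eq, EuclideanSpace.real_norm_sq_eq,
    ofLp_toEuclideanCLM]
  simp only [Fin.sum_univ_two, mulVec, dotProduct, of_apply, cons_val', cons_val_zero,
    cons_val_one, cons_val_fin_one]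
  have h1 : w ^ 2 ≤ (|w| + 1) ^ 2 - 1 := by
    have := abs_nonneg w
    have := sq_abs w
    nlinarith
  have h2 : 0 ≤ x.ofLp 0 ^ 2 := sq_nonneg _
  have h3 : 0 ≤ x.ofLp 1 ^ 2 := sq_nonneg _
  have h4 := mul_le_mul_of_nonneg_right h1 h2
  have h5 : 1 ≤ (|w| + 1) ^ 2 := by nlinarith [abs_nonneg w]
  have h6 := mul_le_mul_of_nonneg_right h5 h3
  have h7 := mul_le_mul_of_nonneg_right h5 h2
  nlinarith [sq_nonneg (w * x.ofLp 0 + x.ofLp 1)]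

theorem continuous_norm_toEuclideanCLM :
    Continuous fun M : Fin 2 → Fin 2 → ℝ =>
      ‖toEuclideanCLM (n := Fin 2) (𝕜 := ℝ) (Matrix.of M)‖ := by
  let Φ : (Fin 2 → Fin 2 → ℝ) →ₗ[ℝ]
      (EuclideanSpace ℝ (Fin 2) →L[ℝ] EuclideanSpace ℝ (Fin 2)) :=
    { toFun := fun M => toEuclideanCLM (n := Fin 2) (𝕜 := ℝ) (Matrix.of M)
      map_add' := fun A B => map_add (toEuclideanCLM (n := Fin 2) (𝕜 := ℝ)) (Matrix.of A) _
      map_smul' := fun c A => map_smul (toEuclideanCLM (n := Fin 2) (𝕜 := ℝ)) c (Matrix.of A) }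
  exact (LinearMap.continuous_of_finiteDimensional Φ).norm

end MatrixNorm

/-! ### Transfer matrices over the skew product -/

section Cocycle

variable {Y : Type*} (v : C(UnitAddCircle, ℝ)) (lam : ℝ) (f : Y → UnitAddCircle) (g : Y → Y)
  (E : ℝ)

theorem skewMap_iterate (x : UnitAddCircle) (y : Y) (n : ℕ) :
    (skewMap f g)^[n] (x, y) = (x + ∑ j ∈ Finset.range n, f (g^[j] y), g^[n] y) := by
  induction n with
  | zero => simp
  | succ n ih =>
    rw [Function.iterate_succ_apply', ih, skewMap, Finset.sum_range_succ,
      Function.iterate_succ_apply', add_assoc]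

theorem det_transferMatrix (p : UnitAddCircle × Y) (n : ℕ) :
    (transferMatrix v lam f g E p n).det = 1 := by
  induction n with
  | zero => simp [transferMatrix]
  | succ n ih => rw [transferMatrix, Matrix.det_mul, ih, Matrix.det_fin_two]; simp

theorem potential_iterate (p : UnitAddCircle × Y) (k n : ℕ) :
    potential v lam f g ((skewMap f g)^[k] p) n = potential v lam f g p (n + k) := by
  rw [potential, potential, Function.iterate_add_apply]

theorem transferMatrix_add (p : UnitAddCircle × Y) (n k : ℕ) :
    transferMatrix v lam f g E p (n + k) =
      transferMatrix v lam f g E ((skewMap f g)^[k] p) n * transferMatrix v lam f g E p k := by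
  induction n with
  | zero => simp [transferMatrix]
  | succ n ih =>
    rw [Nat.add_right_comm, transferMatrix, ih, transferMatrix, potential_iterate,
      Nat.add_right_comm, Matrix.mul_assoc]

theorem transferMatrix_column (p : UnitAddCircle × Y) (n : ℕ) :
    transferColumn (fun j => ((E - potential v lam f g p j : ℝ) : ℂ)) n =
      (((transferMatrix v lam f g E p n 0 0 : ℝ) : ℂ),
        ((transferMatrix v lam f g E p n 1 0 : ℝ) : ℂ)) := by
  induction n with
  | zero => simp [transferColumn, transferMatrix]
  | succ n ih =>
    rw [transferColumn, ih, transferMatrix]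
    simp [Matrix.mul_apply, Fin.sum_univ_two, sub_eq_add_neg]

theorem abs_transferMatrix_le_exp_logNorm (p : UnitAddCircle × Y) (n : ℕ) (i j : Fin 2) :
    |transferMatrix v lam f g E p n i j| ≤ Real.exp (logNorm v lam f g E n p) := by
  have := half_le_norm_toEuclideanCLM (det_transferMatrix v lam f g E p n)
  rw [logNorm, Real.exp_log (by linarith)]
  exact abs_apply_le_norm_toEuclideanCLM _ _ _

theorem neg_log_two_le_logNorm (p : UnitAddCircle × Y) (n : ℕ) :
    -Real.log 2 ≤ logNorm v lam f g E n p := by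
  have := half_le_norm_toEuclideanCLM (det_transferMatrix v lam f g E p n)
  have h := Real.log_le_log (by norm_num) this
  rwa [one_div, Real.log_inv] at h

theorem logNorm_add_le (p : UnitAddCircle × Y) (n k : ℕ) :
    logNorm v lam f g E (n + k) p ≤
      logNorm v lam f g E n ((skewMap f g)^[k] p) + logNorm v lam f g E k p := by
  have h1 := half_le_norm_toEuclideanCLM
    (det_transferMatrix v lam f g E ((skewMap f g)^[k] p) n)
  have h2 := half_le_norm_toEuclideanCLM (det_transferMatrix v lam f g E p k)
  have h3 := half_le_norm_toEuclideanCLM (det_transferMatrix v lam f g E p (n + k))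
  rw [logNorm, logNorm, logNorm, ← Real.log_mul (by linarith) (by linarith)]
  refine Real.log_le_log (by linarith) ?_
  rw [transferMatrix_add, map_mul]
  exact norm_mul_le _ _

theorem logNorm_le {B : ℝ} (p : UnitAddCircle × Y)
    (hB : ∀ j, |E - potential v lam f g p j| ≤ B) (n : ℕ) :
    logNorm v lam f g E n p ≤ n * Real.log (2 * (B + 1)) := by
  have hB0 : 0 ≤ B := (abs_nonneg _).trans (hB 0)
  have hle : ‖Matrix.toEuclideanCLM (n := Fin 2) (𝕜 := ℝ) (transferMatrix v lam f g E p n)‖ ≤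
      (2 * (B + 1)) ^ n := by
    induction n with
    | zero => rw [transferMatrix, map_one, pow_zero]; exact ContinuousLinearMap.norm_id_le
    | succ n ih =>
      rw [transferMatrix, map_mul, pow_succ']
      refine (norm_mul_le _ _).trans (mul_le_mul ?_ ih (norm_nonneg _) (by positivity))
      refine (norm_toEuclideanCLM_step_le _).trans ?_
      linarith [hB (n + 1)]
  have := half_le_norm_toEuclideanCLM (det_transferMatrix v lam f g E p n)
  rw [← Real.log_pow, logNorm]
  exact Real.log_le_log (by linarith) hle

theorem abs_sub_potential_le (hlam : 0 ≤ lam) (p : UnitAddCircle × Y) (j : ℕ) :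
    |E - potential v lam f g p j| ≤ |E| + lam * ‖v‖ := by
  refine (abs_sub _ _).trans (add_le_add_right ?_ _)
  rw [potential, abs_mul, abs_of_nonneg hlam]
  exact mul_le_mul_of_nonneg_left (v.norm_coe_le_norm _) hlam

/-- For fixed `y` the orbit moves `x` by translations, so no regularity of `f` or `g` is needed.
This continuity feeds the Riemann sums of the three lines argument. -/
theorem continuous_logNorm_left (y : Y) (n : ℕ) :
    Continuous fun x => logNorm v lam f g E n (x, y) := by
  have hpot : ∀ j, Continuous fun x => potential v lam f g (x, y) j := by
    intro j
    simp only [potential, skewMap_iterate]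
    fun_prop
  have hM : Continuous fun x => transferMatrix v lam f g E (x, y) n := by
    induction n with
    | zero => exact continuous_const
    | succ n ih =>
      refine Continuous.matrix_mul ?_ ih
      refine continuous_matrix fun i j => ?_
      have := hpot (n + 1)
      fin_cases i <;> fin_cases j <;> simp <;> fun_prop
  refine Continuous.log (continuous_norm_toEuclideanCLM.comp hM) fun x => ?_
  have := half_le_norm_toEuclideanCLM (det_transferMatrix v lam f g E (x, y) n)
  exact (lt_of_lt_of_le (by norm_num) this).ne'

theorem measurable_logNorm [MeasurableSpace Y] (hT : Measurable (skewMap f g)) (n : ℕ) :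
    Measurable (logNorm v lam f g E n) := by
  have hpot : ∀ j, Measurable fun p => potential v lam f g p j := fun j =>
    (v.continuous.measurable.comp (measurable_fst.comp (hT.iterate j))).const_mul lam
  have hM : ∀ i j, Measurable fun p => transferMatrix v lam f g E p n i j := by
    induction n with
    | zero => exact fun i j => measurable_const
    | succ n ih =>
      intro i j
      simp only [transferMatrix, Matrix.mul_apply, Fin.sum_univ_two]
      have := hpot (n + 1)
      fin_cases i <;> simp <;> fun_prop
  have hM' : Measurable fun p => (fun i j => transferMatrix v lam f g E p n i j) :=
    measurable_pi_lambda _ fun i => measurable_pi_lambda _ fun j => hM i j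
  exact (continuous_norm_toEuclideanCLM.measurable.comp hM').log

theorem integrable_logNorm [MeasurableSpace Y] {μ : Measure (UnitAddCircle × Y)}
    [IsFiniteMeasure μ] (hlam : 0 ≤ lam) (hT : Measurable (skewMap f g)) (n : ℕ) :
    Integrable (logNorm v lam f g E n) μ := by
  refine Integrable.of_bound (measurable_logNorm v lam f g E hT n).aestronglyMeasurable
    (Real.log 2 + n * Real.log (2 * (|E| + lam * ‖v‖ + 1))) (ae_of_all _ fun p => ?_)
  have h1 := neg_log_two_le_logNorm v lam f g E p n
  have h2 := logNorm_le v lam f g E p (abs_sub_potential_le v lam f g E hlam p) n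
  have h3 : 0 ≤ Real.log 2 := Real.log_nonneg (by norm_num)
  have h4 : 0 ≤ lam * ‖v‖ := by positivity
  have h5 : 0 ≤ n * Real.log (2 * (|E| + lam * ‖v‖ + 1)) :=
    mul_nonneg n.cast_nonneg (Real.log_nonneg (by linarith [abs_nonneg E]))
  rw [Real.norm_eq_abs, abs_le]
  constructor <;> linarith

theorem subadditive_integral_logNorm [MeasurableSpace Y] {μ : Measure (UnitAddCircle × Y)}
    [IsFiniteMeasure μ] (hlam : 0 ≤ lam) (hT : MeasurePreserving (skewMap f g) μ μ) :
    Subadditive fun n => ∫ p, logNorm v lam f g E n p ∂μ := by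
  intro n k
  have hk := hT.iterate k
  have hint := integrable_logNorm v lam f g E (μ := μ) hlam hT.measurable
  have h1 : ∫ p, logNorm v lam f g E n ((skewMap f g)^[k] p) ∂μ =
      ∫ p, logNorm v lam f g E n p ∂μ := by
    conv_rhs => rw [← hk.map_eq]
    rw [integral_map hk.measurable.aemeasurable
      (measurable_logNorm v lam f g E hT.measurable n).aestronglyMeasurable]
  have h2 : Integrable (fun p => logNorm v lam f g E n ((skewMap f g)^[k] p)) μ :=
    hk.integrable_comp_of_integrable (hint n)
  beta_reduce
  rw [← h1, ← integral_add h2 (hint k)]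
  exact integral_mono (hint _) (h2.add (hint k)) fun p => logNorm_add_le v lam f g E p n k

end Cocycle

/-! ### Lower bound on each fibre -/

section LyapunovBounds

open Set

theorem exists_le_integral_logNorm {v : C(UnitAddCircle, ℝ)}
    (hv : AnalyticOnNhd ℝ (fun x : ℝ => v (x : UnitAddCircle)) univ)
    (hne : ∃ a b : UnitAddCircle, v a ≠ v b) (R : ℝ) :
    ∃ C lam₀ : ℝ, ∀ {Y : Type*} (f : Y → UnitAddCircle) (g : Y → Y) (lam E : ℝ), lam₀ ≤ lam →
      |E| ≤ lam * R → ∀ (y : Y) (n : ℕ),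
        n * (Real.log lam - C) ≤ ∫ x, logNorm v lam f g E n (x, y) := by
  obtain ⟨r, hr, V, hVd, hVu, hVper⟩ := exists_strip_extension hv (fun x => by simp)
  set ρ := r / 2 with hρdef
  have hρ : 0 < ρ := by positivity
  have hρr : ρ < r := by linarith
  have hVne : ∃ s t : ℝ, V s ≠ V t := by
    obtain ⟨a, b, hab⟩ := hne
    obtain ⟨s, rfl⟩ := QuotientAddGroup.mk_surjective a
    obtain ⟨t, rfl⟩ := QuotientAddGroup.mk_surjective b
    exact ⟨s, t, by rw [hVu, hVu]; exact_mod_cast hab⟩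
  -- Heights are limited to `ρ / 2` so that the weight `σ = ε / ρ` is at most `1/2`, and `1 - σ`
  -- stays away from zero.
  obtain ⟨δ, hδ, hline⟩ := exists_line_norm_sub_ge_uniform (half_pos hρ)
    ((half_lt_self hρ).trans hρr) hVd hVper hVne (isCompact_closedBall (0 : ℂ) R)
  obtain ⟨B₀, hB₀⟩ := exists_norm_le_of_periodic hρr hVd.continuousOn hVper
  have hB₀0 : 0 ≤ B₀ := (norm_nonneg _).trans (hB₀ 0 (by simpa using hρ.le))
  set b := |R| + B₀ + 1 with hb
  have hb0 : 0 < b := by positivity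
  -- The factor `2` bounds `1 / (1 - σ)`. The condition `lam ≥ 2 / δ` gives `lam * δ ≥ lam * (δ / 2)
  -- + 1`, as the cone argument requires.
  refine ⟨2 * (|Real.log (δ / 2)| + |Real.log b|), max 1 (2 / δ),
    fun {Y} f g lam E hlam hE y n => ?_⟩
  have hlam1 : 1 ≤ lam := (le_max_left _ _).trans hlam
  have hlam0 : 0 < lam := by linarith
  have hK : 1 ≤ lam * (δ / 2) := by
    have := (le_max_right _ _).trans hlam
    rw [div_le_iff₀ hδ] at this
    linarith
  obtain ⟨ε, hε, hεx⟩ := hline ((E / lam : ℝ) : ℂ) (by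
    rw [mem_closedBall_zero_iff, Complex.norm_real, Real.norm_eq_abs, abs_div, abs_of_pos hlam0,
      div_le_iff₀ hlam0]
    linarith)
  -- Real lifts of the accumulated rotations let the orbit be followed off the real axis:
  -- translation by `θ j` preserves heights.
  choose θ hθ using fun j : ℕ =>
    QuotientAddGroup.mk_surjective (∑ i ∈ Finset.range j, f (g^[i] y))
  set W : ℕ → ℂ → ℂ := fun j z => E - lam * V (z + (θ j : ℂ)) with hW
  have hWlow : ∀ (x : ℝ) (j : ℕ), lam * (δ / 2) + 1 ≤ ‖W j (x + ε * Complex.I)‖ := by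
    intro x j
    have h1 : W j (x + ε * Complex.I) =
        -((lam : ℂ) * (V (((x + θ j : ℝ) : ℂ) + ε * Complex.I) - ((E / lam : ℝ) : ℂ))) := by
      have hlamC : (lam : ℂ) ≠ 0 := by exact_mod_cast hlam0.ne'
      rw [hW]
      push_cast
      rw [mul_sub, mul_div_cancel₀ _ hlamC, add_right_comm]
      ring
    rw [h1, norm_neg, norm_mul, Complex.norm_real, Real.norm_eq_abs, abs_of_pos hlam0]
    have := mul_le_mul_of_nonneg_left (hεx (x + θ j)) hlam0.le
    linarith
  have hWup : ∀ z : ℂ, |z.im| ≤ ρ → ∀ j, ‖W j z‖ ≤ lam * (|R| + B₀) := by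
    intro z hz j
    refine (norm_sub_le _ _).trans ?_
    rw [norm_mul, Complex.norm_real, Complex.norm_real, Real.norm_eq_abs, Real.norm_eq_abs,
      abs_of_pos hlam0, mul_add]
    refine add_le_add (hE.trans (mul_le_mul_of_nonneg_left (le_abs_self R) hlam0.le))
      (mul_le_mul_of_nonneg_left (hB₀ _ (by simpa using hz)) hlam0.le)
  have hWd : ∀ j, DifferentiableOn ℂ (W j) (strip r) := by
    intro j
    refine (differentiableOn_const _).sub ((differentiableOn_const _).mul ?_)
    exact hVd.comp (by fun_prop) fun z hz => by simpa [strip] using hz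
  have hσ0 : 0 < ε / ρ := div_pos hε.1 hρ
  have hσ : ε / ρ ≤ 1 / 2 := by
    rw [div_le_iff₀ hρ]
    linarith [hε.2]
  have key := log_le_of_norm_ge_on_line (K := (lam * (δ / 2)) ^ n) (B := (lam * b) ^ n) hε.1
    (hε.2.trans (half_le_self hρ.le)) hρr (by positivity) (by positivity)
    (differentiableOn_transferColumn hWd n).1
    (fun x => (transferColumn_lower hK (hWlow x) n).1)
    (fun z hz => (transferColumn_upper (hWup z hz) n).1.trans (by
      gcongr
      rw [hb]
      linarith))
    (continuous_logNorm_left v lam f g E y n) (fun x => by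
      have hcol : (fun j => W j x) =
          fun j => ((E - potential v lam f g ((x : UnitAddCircle), y) j : ℝ) : ℂ) := by
        funext j
        have : ((x : UnitAddCircle) + ∑ i ∈ Finset.range j, f (g^[i] y)) =
            ((x + θ j : ℝ) : UnitAddCircle) := by
          rw [← hθ]; rfl
        rw [hW, potential, skewMap_iterate]
        simp only
        rw [this, ← Complex.ofReal_add, hVu]
        push_cast
        rfl
      rw [hcol, transferMatrix_column, Complex.norm_real, Real.norm_eq_abs]
      exact abs_transferMatrix_le_exp_logNorm v lam f g E _ n 0 0)
  set J := ∫ x, logNorm v lam f g E n (x, y)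
  set σ := ε / ρ
  rw [Real.log_pow, Real.log_pow, Real.log_mul hlam0.ne' (by positivity),
    Real.log_mul hlam0.ne' hb0.ne'] at key
  have hn : (0 : ℝ) ≤ n := n.cast_nonneg
  set A := |Real.log (δ / 2)|
  set B := |Real.log b|
  have hA : -A ≤ Real.log (δ / 2) := neg_abs_le _
  have hB : σ * Real.log b ≤ B :=
    (mul_le_mul_of_nonneg_left (le_abs_self _) hσ0.le).trans
      (mul_le_of_le_one_left (abs_nonneg _) (by linarith))
  have hAB : 0 ≤ A + B := by positivity
  -- The terms in `log lam` combine with coefficient exactly `1 - σ`, which then cancels.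
  have h2 : (1 - σ) * (n * (Real.log lam - 2 * (A + B))) ≤ (1 - σ) * J := by
    have h3 : A + B ≤ (1 - σ) * (2 * (A + B)) := by nlinarith
    have h4 := mul_le_mul_of_nonneg_left hA hn
    have h5 := mul_le_mul_of_nonneg_left hB hn
    have h6 := mul_le_mul_of_nonneg_left h3 hn
    linarith
  exact le_of_mul_le_mul_left h2 (by linarith)

theorem finiteLyapunov_eq {Y : Type*} [MeasurableSpace Y] {m : Measure Y} [SFinite m]
    {v : C(UnitAddCircle, ℝ)} {lam : ℝ} {f : Y → UnitAddCircle} {g : Y → Y} {E : ℝ} {n : ℕ}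
    (h : Integrable (logNorm v lam f g E n) ((volume : Measure UnitAddCircle).prod m)) :
    finiteLyapunov m v lam f g E n =
      (∫ p, logNorm v lam f g E n p ∂((volume : Measure UnitAddCircle).prod m)) / n := by
  rw [finiteLyapunov, integral_prod_symm _ h, one_div, inv_mul_eq_div]

end LyapunovBounds

end SkewSchrodinger

end

/-! ### Existence and bounds of the Lyapunov exponent -/

theorem theorem1p1 (v : C(UnitAddCircle, ℝ))
    (hv : AnalyticOnNhd ℝ (fun x : ℝ => v (x : UnitAddCircle)) Set.univ)
    (hv_nonconst : ∃ a b : UnitAddCircle, v a ≠ v b)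
    (κ : ℝ) (hκ : 0 < κ) :
    ∃ lam₀ : ℝ, ∀ (Y : Type*) [MeasurableSpace Y] (m : Measure Y) [IsProbabilityMeasure m]
      (f : Y → UnitAddCircle) (g : Y → Y),
      MeasurePreserving (SkewSchrodinger.skewMap f g)
        ((volume : Measure UnitAddCircle).prod m) ((volume : Measure UnitAddCircle).prod m) →
      ∀ lam : ℝ, lam₀ < lam →
      ∀ (p : UnitAddCircle × Y) (E : ℝ),
        (E : ℂ) ∈ spectrum ℂ (SkewSchrodinger.schrodingerOp v lam f g p) →
        (∀ n : ℕ, Integrable (SkewSchrodinger.logNorm v lam f g E n)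
          ((volume : Measure UnitAddCircle).prod m)) ∧
        ∃ L : ℝ,
          Tendsto (fun n : ℕ => SkewSchrodinger.finiteLyapunov m v lam f g E n) atTop (𝓝 L) ∧
          (1 - κ) * Real.log lam < L ∧ L < (1 + κ) * Real.log lam := by
  set R := 3 * (‖v‖ + 2)
  obtain ⟨C, lam₁, hC⟩ := SkewSchrodinger.exists_le_integral_logNorm hv hv_nonconst R
  set b := 2 * (R + ‖v‖ + 1) with hb
  have hb0 : 0 < b := by positivity
  -- The exponential is chosen so that `κ log lam` exceeds the constant losses of both bounds.
  refine ⟨max (max 1 lam₁) (Real.exp ((|C| + |Real.log b|) / κ)), ?_⟩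
  intro Y _ m _ f g hT lam hlam p E hE
  have hlam1 : 1 ≤ lam := ((le_max_left _ _).trans (le_max_left _ _)).trans hlam.le
  have hlam₁ : lam₁ ≤ lam := ((le_max_right _ _).trans (le_max_left _ _)).trans hlam.le
  have hlam0 : 0 < lam := by linarith
  have hκlam : |C| + |Real.log b| < κ * Real.log lam := by
    have h := Real.log_lt_log (Real.exp_pos _) ((le_max_right _ _).trans_lt hlam)
    rw [Real.log_exp, div_lt_iff₀ hκ] at h
    linarith
  have hER : |E| ≤ lam * R := SkewSchrodinger.abs_le_of_mem_spectrum hlam1 hE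
  set μ := (volume : Measure UnitAddCircle).prod m with hμ
  have : IsProbabilityMeasure (volume : Measure UnitAddCircle) := ⟨UnitAddCircle.measure_univ⟩
  have : IsProbabilityMeasure μ := by rw [hμ]; infer_instance
  have hint : ∀ n, Integrable (SkewSchrodinger.logNorm v lam f g E n) μ :=
    SkewSchrodinger.integrable_logNorm v lam f g E hlam0.le hT.measurable
  have hsub := SkewSchrodinger.subadditive_integral_logNorm v lam f g E hlam0.le hT
  set u : ℕ → ℝ := fun n => ∫ q, SkewSchrodinger.logNorm v lam f g E n q ∂μ with hu
  have hlow : ∀ n : ℕ, n * (Real.log lam - C) ≤ u n := by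
    intro n
    have h1 : u n = ∫ y, ∫ x, SkewSchrodinger.logNorm v lam f g E n (x, y) ∂volume ∂m :=
      integral_prod_symm _ (hint n)
    rw [h1]
    have h2 := integral_mono (μ := m) (integrable_const (n * (Real.log lam - C)))
      (hint n).integral_prod_right (hC f g lam E hlam₁ hER · n)
    simpa using h2
  have hup : ∀ n : ℕ, u n ≤ n * Real.log (lam * b) := by
    intro n
    have h1 : ∀ q, SkewSchrodinger.logNorm v lam f g E n q ≤ n * Real.log (lam * b) := by
      intro q
      refine (SkewSchrodinger.logNorm_le v lam f g E q (B := lam * (R + ‖v‖)) (fun j => ?_) n).trans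
        ?_
      · refine (SkewSchrodinger.abs_sub_potential_le v lam f g E hlam0.le q j).trans ?_
        linarith
      · have : 2 * (lam * (R + ‖v‖) + 1) ≤ lam * b := by
          rw [hb]
          linarith
        gcongr
    have h2 := integral_mono (hint n) (integrable_const (n * Real.log (lam * b))) h1
    simpa only [integral_const, probReal_univ, one_smul] using h2
  have hnpos : ∀ᶠ n : ℕ in atTop, (0 : ℝ) < n :=
    (eventually_gt_atTop 0).mono fun n hn => by exact_mod_cast hn
  have hbdd : BddBelow (Set.range fun n => u n / n) := by
    -- The `0` covers `n = 0`, where the quotient `u 0 / 0` is `0` by convention.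
    refine ⟨min 0 (Real.log lam - C), ?_⟩
    rintro _ ⟨n, rfl⟩
    rcases n.eq_zero_or_pos with rfl | hn
    · simp
    · have hn' : (0 : ℝ) < n := by exact_mod_cast hn
      refine (min_le_right _ _).trans ((le_div_iff₀ hn').2 ?_)
      linarith [hlow n]
  have hlim := hsub.tendsto_lim hbdd
  refine ⟨hint, hsub.lim, ?_, ?_, ?_⟩
  · exact hlim.congr fun n => (SkewSchrodinger.finiteLyapunov_eq (hint n)).symm
  · have h : Real.log lam - C ≤ hsub.lim := by
      refine ge_of_tendsto hlim (hnpos.mono fun n hn => (le_div_iff₀ hn).2 ?_)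
      linarith [hlow n]
    linarith [le_abs_self C, abs_nonneg (Real.log b)]
  · have h : hsub.lim ≤ Real.log (lam * b) := by
      refine le_of_tendsto hlim (hnpos.mono fun n hn => (div_le_iff₀ hn).2 ?_)
      linarith [hup n]
    rw [Real.log_mul hlam0.ne' hb0.ne'] at h
    linarith [le_abs_self (Real.log b), abs_nonneg C]
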